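/- A sign pattern of order $n$ is an $n\times n$ matrix $\mathcal{P}=[p_{ij}]$ with entries in $\{+,-,0\}$, and its qualitative class $\mathcal{Q}(\mathcal{P})$ is the set of all real $n\times n$ matrices $A=[a_{ij}]$ with $\operatorname{sgn}(a_{ij})=p_{ij}$ for all $i,j$. The pattern $\mathcal{P}$ is called consistent if there is an integer $k$ with $0\le k\le n$ such that every $A\in\mathcal{Q}(\mathcal{P})$ has exactly $k$ real eigenvalues, counted with algebraic multiplicity. It is called irreducible if there is no nonempty proper subset $S$ of $\{1,\dots,n\}$ such that $p_{ij}=0$ for all $i\in S$, $j\notin S$; tridiagonal if $p_{ij}=0$ whenever $|i-j|>1$; and it has a $0$-diagonal if $p_{ii}=0$ for all $i$. Theorem. Let $\mathcal{P}$ be an irreducible, tridiagonal sign pattern of order $n$ with a $0$-diagonal. If $\mathcal{P}$ is consistent, then for every $A\in\mathcal{Q}(\mathcal{P})$ the algebraic multiplicity of $0$ as an eigenvalue of $A$ is at most one. -/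

import Mathlib

/-- An `n × n` sign pattern: a matrix with entries in `{+, -, 0}`. -/
abbrev SignPattern (n : ℕ) : Type := Matrix (Fin n) (Fin n) SignType

namespace SignPattern

variable {n : ℕ}

/-- The qualitative class: all real matrices whose entries have the prescribed signs. -/
def qualitativeClass (P : SignPattern n) : Set (Matrix (Fin n) (Fin n) ℝ) :=
  {A | ∀ i j, SignType.sign (A i j) = P i j}

/-- The number of real eigenvalues of a real matrix, counted with algebraic multiplicity
(the number of real roots, with multiplicity, of the characteristic polynomial). -/
noncomputable def realEigenvalueCount (A : Matrix (Fin n) (Fin n) ℝ) : ℕ :=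
  Multiset.card A.charpoly.roots

/-- `P` is `k`-consistent, `0 ≤ k ≤ n`: every matrix in its qualitative class has exactly `k`
real eigenvalues. -/
def IsKConsistent (P : SignPattern n) (k : ℕ) : Prop :=
  k ≤ n ∧ ∀ A ∈ P.qualitativeClass, realEigenvalueCount A = k

/-- `P` is consistent: it is `k`-consistent for some `0 ≤ k ≤ n`. -/
def IsConsistent (P : SignPattern n) : Prop :=
  ∃ k : ℕ, P.IsKConsistent k

/-- `P` is irreducible: it is not permutation similar to a block triangular pattern with two
nonempty square diagonal blocks, i.e. no off-diagonal block `P[S, Sᶜ]` with `S` a nonempty proper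
set of indices vanishes. -/
def IsIrreducible (P : SignPattern n) : Prop :=
  ∀ S : Set (Fin n), S.Nonempty → Sᶜ.Nonempty → ∃ i ∈ S, ∃ j ∈ Sᶜ, P i j ≠ 0

/-- `P` is tridiagonal: `P i j = 0` whenever `|i - j| > 1`. -/
def IsTridiagonal (P : SignPattern n) : Prop :=
  ∀ i j : Fin n, (i : ℕ) + 1 < j ∨ (j : ℕ) + 1 < i → P i j = 0

/-- `P` has a `0`-diagonal. -/
def HasZeroDiagonal (P : SignPattern n) : Prop :=
  ∀ i : Fin n, P i i = 0

end SignPattern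

open Polynomial

namespace SignPattern

/-! Irreducibility makes every entry next to the diagonal nonzero. For even order the determinant is
then, up to sign, a product of such entries, so 0 is not an eigenvalue.

For odd order the characteristic polynomial is odd, and a multiple eigenvalue 0 means that its
linear coefficient vanishes. Scaling the first row by t > 0 stays in the qualitative class and turns
this coefficient into (1 - t)d, where d is the determinant of the trailing principal submatrix,
nonzero because its order is even. So the coefficient takes both signs within the class. But its
sign fixes the number of real roots mod 4 (`card_roots_mod_four_of_odd`), which contradicts
consistency. -/

/-- An odd monic real polynomial with nonzero linear coefficient `c` has `1` mod `4` real roots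
if `c > 0` and `3` mod `4` real roots if `c < 0`. -/
theorem card_roots_mod_four_of_odd : ∀ (d : ℕ) (p : ℝ[X]), p.natDegree = d → p.Monic →
    p.comp (-X) = -p → p.coeff 1 ≠ 0 →
    (0 < p.coeff 1 → Multiset.card p.roots % 4 = 1) ∧
      (p.coeff 1 < 0 → Multiset.card p.roots % 4 = 3) := by
  intro d
  induction d using Nat.strong_induction_on with
  | _ d ih =>
  intro p hd hp hodd hc
  have hev : ∀ x, p.eval (-x) = -p.eval x := by
    intro x
    have := congrArg (eval x) hodd
    simpa using this
  by_cases hr : ∃ r, r ≠ 0 ∧ p.IsRoot r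
  · obtain ⟨r, hr0, hr⟩ := hr
    obtain ⟨h, hh⟩ := dvd_iff_isRoot.mpr hr
    have hnr : h.IsRoot (-r) := by
      have h1 : p.eval (-r) = 0 := by rw [hev, hr.eq_zero, neg_zero]
      rw [hh] at h1
      simp only [eval_mul, eval_sub, eval_X, eval_C, mul_eq_zero] at h1
      rcases h1 with h1 | h1
      · exact absurd (by linarith) hr0
      · exact h1
    obtain ⟨q, rfl⟩ := dvd_iff_isRoot.mpr hnr
    have hm1 : (X - C r).Monic := monic_X_sub_C r
    have hm2 : (X - C (-r)).Monic := monic_X_sub_C (-r)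
    have hq : q.Monic := hm2.of_mul_monic_left (hm1.of_mul_monic_left (hh ▸ hp))
    have hdeg : p.natDegree = q.natDegree + 2 := by
      rw [hh, hm1.natDegree_mul (hm2.mul hq), hm2.natDegree_mul hq, natDegree_X_sub_C,
        natDegree_X_sub_C]
      ring
    have hfac : p = (X ^ 2 - C (r ^ 2)) * q := by
      rw [hh]
      simp only [C_neg, C_pow]
      ring
    have hqodd : q.comp (-X) = -q := by
      have hne : (X ^ 2 - C (r ^ 2) : ℝ[X]) ≠ 0 := X_pow_sub_C_ne_zero (by norm_num) _
      apply mul_left_cancel₀ hne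
      have h2 := hodd
      rw [hfac] at h2
      simp only [mul_comp, sub_comp, pow_comp, X_comp, C_comp, neg_sq] at h2
      rw [h2]
      ring
    -- Removing the pair ±r flips the sign of the linear coefficient and lowers the count by 2,
    -- which exchanges the residues 1 and 3 mod 4.
    have hcoeff : p.coeff 1 = -(r ^ 2) * q.coeff 1 := by
      rw [hfac, sub_mul, coeff_sub, coeff_C_mul, coeff_X_pow_mul']
      simp
    have hr2 : 0 < r ^ 2 := by positivity
    have hqc : q.coeff 1 ≠ 0 := by
      intro h0
      exact hc (by rw [hcoeff, h0, mul_zero])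
    have hcard : Multiset.card p.roots = Multiset.card q.roots + 2 := by
      rw [hh, roots_mul (hh ▸ hp.ne_zero), roots_mul (hm2.mul hq).ne_zero, roots_X_sub_C,
        roots_X_sub_C]
      simp
    obtain ⟨ih1, ih2⟩ := ih q.natDegree (by omega) q rfl hq hqodd hqc
    refine ⟨fun h => ?_, fun h => ?_⟩
    · have := ih2 (by by_contra! h'; nlinarith)
      omega
    · have := ih1 (by by_contra! h'; nlinarith)
      omega
  · push Not at hr
    have h0 : p.IsRoot 0 := by
      have := hev 0
      rw [neg_zero] at this
      exact show p.eval 0 = 0 by linarith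
    obtain ⟨g, hg⟩ := dvd_iff_isRoot.mpr h0
    rw [C_0, sub_zero] at hg
    have hgm : g.Monic := monic_X.of_mul_monic_left (hg ▸ hp)
    have hg0 : g.eval 0 = p.coeff 1 := by
      rw [hg, coeff_X_mul, coeff_zero_eq_eval_zero]
    have hgr : ∀ x, g.eval x ≠ 0 := by
      intro x hx
      by_cases hx0 : x = 0
      · subst hx0
        exact hc (hg0 ▸ hx)
      · exact hr x hx0 (by rw [IsRoot, hg, eval_mul, hx, mul_zero])
    -- A monic real polynomial without real roots is positive everywhere, in particular at 0.
    have hpos : 0 < p.coeff 1 := by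
      by_contra! hneg
      by_cases hdg : 0 < g.degree
      · have ht := g.tendsto_atTop_of_leadingCoeff_nonneg hdg (by rw [hgm.leadingCoeff]; norm_num)
        obtain ⟨b, hb, hb0⟩ :=
          ((ht.eventually_ge_atTop 0).and (Filter.eventually_ge_atTop 0)).exists
        obtain ⟨x, -, hx⟩ := intermediate_value_Icc hb0 g.continuous.continuousOn
          (show (0 : ℝ) ∈ Set.Icc _ _ from ⟨hg0 ▸ hneg, hb⟩)
        exact hgr x hx
      · have : g = 1 := hgm.natDegree_eq_zero.mp (natDegree_eq_zero_iff_degree_le_zero.mpr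
          (not_lt.mp hdg))
        rw [this, eval_one] at hg0
        linarith
    refine ⟨fun _ => ?_, fun h => absurd h (not_lt.mpr hpos.le)⟩
    have hgroots : g.roots = 0 :=
      Multiset.eq_zero_of_forall_notMem fun x hx => hgr x (isRoot_of_mem_roots hx)
    rw [hg, roots_mul (hg ▸ hp.ne_zero), roots_X, hgroots]
    simp

/-- A tridiagonal matrix of even order with zero diagonal and nonzero off-diagonal entries is
nonsingular. -/
theorem det_ne_zero_of_tridiagonal_of_even : ∀ (k : ℕ) (A : Matrix (Fin (2 * k)) (Fin (2 * k)) ℝ),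
    (∀ i j : Fin (2 * k), A i j ≠ 0 ↔ (i : ℕ) + 1 = j ∨ (j : ℕ) + 1 = i) → A.det ≠ 0 := by
  intro k
  induction k with
  | zero => intro A _; simp
  | succ k ih =>
    intro A hA
    change Matrix (Fin (2 * k + 1 + 1)) (Fin (2 * k + 1 + 1)) ℝ at A
    replace hA : ∀ i j : Fin (2 * k + 1 + 1), A i j ≠ 0 ↔ (i : ℕ) + 1 = j ∨ (j : ℕ) + 1 = i := hA
    have hz : ∀ i j : Fin (2 * k + 1 + 1), ¬ ((i : ℕ) + 1 = j ∨ (j : ℕ) + 1 = i) → A i j = 0 :=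
      fun i j h => by
        by_contra h'
        exact h ((hA i j).mp h')
    have h01 : A 0 1 ≠ 0 := (hA 0 1).mpr (by simp)
    have h10 : A 1 0 ≠ 0 := (hA 1 0).mpr (by simp)
    -- Row 0 has its only nonzero entry in column 1; in the remaining minor, column 0 retains only
    -- `A 1 0`.
    have hdet : A.det = -(A 0 1 * A 1 0 * (A.submatrix (fun i : Fin (2 * k) => i.succ.succ)
        (fun i : Fin (2 * k) => i.succ.succ)).det) := by
      rw [Matrix.det_succ_row_zero, Finset.sum_eq_single 1]
      · rw [Matrix.det_succ_column_zero, Finset.sum_eq_single 0]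
        · have hs : ∀ i : Fin (2 * k),
              Fin.succAbove (1 : Fin (2 * k + 1 + 1)) i.succ = i.succ.succ := by
            intro i
            rw [← Fin.succ_zero_eq_one, Fin.succ_succAbove_succ, Fin.succAbove_zero]
          simp [Matrix.submatrix_submatrix, Function.comp_def, hs]
          ring
        · intro i _ hi
          have : A i.succ 0 = 0 := hz _ _ (by
            have : (i : ℕ) ≠ 0 := fun h => hi (Fin.ext h)
            simp
            omega)
          simp [this]
        · simp
      · intro j _ hj
        have : A 0 j = 0 := hz _ _ (by
          have : (j : ℕ) ≠ 1 := fun h => hj (Fin.ext (by simpa using h))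
          simp
          omega)
        simp [this]
      · simp
    rw [hdet]
    refine neg_ne_zero.mpr (mul_ne_zero (mul_ne_zero h01 h10) (ih _ fun i j => ?_))
    rw [Matrix.submatrix_apply, hA]
    simp

/-- Scaling the first row of a matrix interpolates between its
characteristic polynomial and `X` times that of the trailing principal submatrix. -/
theorem charpoly_updateRow_zero_smul {m : ℕ} (A : Matrix (Fin (m + 1)) (Fin (m + 1)) ℝ) (t : ℝ) :
    (A.updateRow 0 (t • A 0)).charpoly =
      (1 - C t) * (X * (A.submatrix Fin.succ Fin.succ).charpoly) + C t * A.charpoly := by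
  -- The diagonal entry X is not scaled with the row; the term (1 - t)X at position 0 makes up for
  -- it, and the determinant is linear in row 0.
  have hM : (A.updateRow 0 (t • A 0)).charmatrix =
      A.charmatrix.updateRow 0 (((1 - C t) * X) • Pi.single 0 1 + C t • A.charmatrix 0) := by
    ext1 i j
    rcases Fin.eq_zero_or_eq_succ i with rfl | ⟨i, rfl⟩
    · rcases Fin.eq_zero_or_eq_succ j with rfl | ⟨j, rfl⟩
      · simp
        ring
      · simp [(Fin.succ_ne_zero j).symm]
    · simp [Matrix.charmatrix_apply]
  have hD : (A.charmatrix.updateRow 0 (Pi.single 0 1)).det =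
      (A.submatrix Fin.succ Fin.succ).charpoly := by
    rw [← Matrix.adjugate_apply, Matrix.adjugate_fin_succ_eq_det_submatrix, Matrix.charpoly]
    simp only [Fin.val_zero, add_zero, pow_zero, one_mul, Fin.succAbove_zero]
    congr 1
    ext1 i j
    simp [Matrix.charmatrix_apply, Matrix.diagonal_apply]
  rw [Matrix.charpoly, hM, Matrix.det_updateRow_add, Matrix.det_updateRow_smul,
    Matrix.det_updateRow_smul, hD]
  have : A.charmatrix.updateRow 0 (A.charmatrix 0) = A.charmatrix := Matrix.updateRow_eq_self _ _
  rw [this, ← Matrix.charpoly]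
  ring

/-- The characteristic polynomial of an odd order matrix whose nonzero entries join indices of
opposite parity is odd. -/
theorem charpoly_comp_neg_X {n : ℕ} (hn : Odd n) (A : Matrix (Fin n) (Fin n) ℝ)
    (hA : ∀ i j : Fin n, A i j ≠ 0 → Odd ((i : ℕ) + j)) :
    A.charpoly.comp (-X) = -A.charpoly := by
  let D : Matrix (Fin n) (Fin n) ℝ[X] := Matrix.diagonal fun i => (-1) ^ (i : ℕ)
  have hDD : D.det * D.det = 1 := by
    rw [← Matrix.det_mul, Matrix.diagonal_mul_diagonal]
    simp [← mul_pow]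
  have hcomp : A.charpoly.comp (-X) = (A.charmatrix.map fun q => q.comp (-X)).det := by
    exact (compRingHom (-X : ℝ[X])).map_det A.charmatrix
  -- Conjugation by alternating signs negates the entries of `A`, which join opposite parities, and
  -- fixes the diagonal X.
  have hM : (A.charmatrix.map fun q => q.comp (-X)) = -(D * A.charmatrix * D) := by
    ext1 i j
    simp only [D, Matrix.map_apply, Matrix.neg_apply, Matrix.mul_diagonal, Matrix.diagonal_mul,
      Matrix.charmatrix_apply, Matrix.diagonal_apply]
    by_cases h0 : A i j = 0
    · by_cases hij : i = j
      · subst hij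
        simp only [h0, if_true, C_0, sub_zero, X_comp]
        rw [mul_right_comm, ← mul_pow]
        simp
      · simp [h0, hij]
    · have hodd := hA i j h0
      have hij : i ≠ j := by
        rintro rfl
        exact (Nat.not_odd_iff_even.mpr (Even.add_self _)) hodd
      simp only [hij, if_false, zero_sub, neg_comp, C_comp]
      rw [mul_right_comm, ← pow_add, hodd.neg_one_pow]
      ring
  rw [hcomp, hM, Matrix.det_neg, Matrix.det_mul, Matrix.det_mul, Fintype.card_fin, hn.neg_one_pow,
    mul_right_comm, hDD, ← Matrix.charpoly]
  ring

variable {n : ℕ}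

/-- The nonzero entries of an irreducible tridiagonal pattern with zero diagonal are exactly the
ones next to the diagonal. -/
theorem ne_zero_iff_of_tridiagonal {P : SignPattern n} (hirr : P.IsIrreducible)
    (htri : P.IsTridiagonal) (hdiag : P.HasZeroDiagonal) (i j : Fin n) :
    P i j ≠ 0 ↔ (i : ℕ) + 1 = j ∨ (j : ℕ) + 1 = i := by
  constructor
  · intro h
    by_contra! hij
    rcases eq_or_ne i j with rfl | hne
    · exact h (hdiag i)
    · have : (i : ℕ) ≠ j := fun h' => hne (Fin.ext h')
      exact h (htri i j (by omega))
  · rintro (h | h)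
    -- Some entry must lead out of the initial segment ending at i; by tridiagonality only (i, i +
    -- 1) can.
    · obtain ⟨a, ha, b, hb, hab⟩ := hirr {k | (k : ℕ) ≤ i} ⟨i, by simp⟩
        ⟨j, by simp only [Set.mem_compl_iff, Set.mem_ofPred_eq]; omega⟩
      simp only [Set.mem_compl_iff, Set.mem_ofPred_eq] at ha hb
      have hn : ¬ ((a : ℕ) + 1 < b) := fun h' => hab (htri a b (Or.inl h'))
      have h1 : a = i := Fin.ext (by omega)
      have h2 : b = j := Fin.ext (by omega)
      rwa [h1, h2] at hab
    · obtain ⟨a, ha, b, hb, hab⟩ := hirr {k | (i : ℕ) ≤ k} ⟨i, by simp⟩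
        ⟨j, by simp only [Set.mem_compl_iff, Set.mem_ofPred_eq]; omega⟩
      simp only [Set.mem_compl_iff, Set.mem_ofPred_eq] at ha hb
      have hn : ¬ ((b : ℕ) + 1 < a) := fun h' => hab (htri a b (Or.inr h'))
      have h1 : a = i := Fin.ext (by omega)
      have h2 : b = j := Fin.ext (by omega)
      rwa [h1, h2] at hab

theorem ne_zero_iff_of_mem_qualitativeClass {P : SignPattern n} {A : Matrix (Fin n) (Fin n) ℝ}
    (hA : A ∈ P.qualitativeClass) (i j : Fin n) : A i j ≠ 0 ↔ P i j ≠ 0 := by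
  rw [← hA i j, Ne, Ne, sign_eq_zero_iff]

theorem updateRow_smul_mem_qualitativeClass {P : SignPattern n} {A : Matrix (Fin n) (Fin n) ℝ}
    (hA : A ∈ P.qualitativeClass) (i : Fin n) {t : ℝ} (ht : 0 < t) :
    A.updateRow i (t • A i) ∈ P.qualitativeClass := by
  intro a b
  rcases eq_or_ne a i with rfl | h
  · simp [sign_mul, sign_pos ht, hA a b]
  · simp [h, hA a b]

end SignPattern

open SignPattern in
theorem theorem3p5 {n : ℕ} (P : SignPattern n) (hirr : P.IsIrreducible)
    (htri : P.IsTridiagonal) (hdiag : P.HasZeroDiagonal) (hcons : P.IsConsistent) :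
    ∀ A ∈ P.qualitativeClass, A.charpoly.rootMultiplicity 0 ≤ 1 := by
  intro A hA
  have hnz : ∀ B ∈ P.qualitativeClass, ∀ i j : Fin n,
      B i j ≠ 0 ↔ (i : ℕ) + 1 = j ∨ (j : ℕ) + 1 = i := fun B hB i j =>
    (ne_zero_iff_of_mem_qualitativeClass hB i j).trans
      (ne_zero_iff_of_tridiagonal hirr htri hdiag i j)
  rcases Nat.even_or_odd' n with ⟨k, rfl | rfl⟩
  · have hdet := det_ne_zero_of_tridiagonal_of_even k A (hnz A hA)
    rw [rootMultiplicity_eq_zero]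
    · exact zero_le_one
    · intro h
      apply hdet
      rw [Matrix.det_eq_sign_charpoly_coeff, coeff_zero_eq_eval_zero, h.eq_zero, mul_zero]
  · by_contra! hmult
    have hcoeff : A.charpoly.coeff 1 = 0 := by
      have h := (le_rootMultiplicity_iff (Matrix.charpoly_monic A).ne_zero).mp
        (show 2 ≤ A.charpoly.rootMultiplicity 0 from hmult)
      rw [C_0, sub_zero] at h
      exact X_pow_dvd_iff.mp h 1 (by norm_num)
    set d := (A.submatrix Fin.succ Fin.succ).charpoly.coeff 0 with hd
    have hd0 : d ≠ 0 := by
      intro h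
      apply det_ne_zero_of_tridiagonal_of_even k (A.submatrix Fin.succ Fin.succ)
      · intro i j
        rw [Matrix.submatrix_apply, hnz A hA]
        simp
      · rw [Matrix.det_eq_sign_charpoly_coeff, ← hd, h, mul_zero]
    have hct : ∀ t : ℝ, (A.updateRow 0 (t • A 0)).charpoly.coeff 1 = (1 - t) * d := by
      intro t
      rw [charpoly_updateRow_zero_smul, ← C_1, ← C_sub, coeff_add, coeff_C_mul, coeff_C_mul,
        coeff_X_mul, hcoeff, mul_zero, add_zero]
    obtain ⟨c, -, hc⟩ := hcons
    have key : ∀ t : ℝ, 0 < t → (1 - t) * d ≠ 0 →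
        (0 < (1 - t) * d → c % 4 = 1) ∧ ((1 - t) * d < 0 → c % 4 = 3) := by
      intro t ht hne
      have hB := updateRow_smul_mem_qualitativeClass hA 0 ht
      have h := card_roots_mod_four_of_odd _ _ rfl (Matrix.charpoly_monic _)
        (charpoly_comp_neg_X ⟨k, rfl⟩ _ fun i j hij => by
          rw [Nat.odd_iff]
          rcases (hnz _ hB i j).mp hij with h | h <;> omega) (by rwa [hct t])
      have hcard := hc _ hB
      rw [realEigenvalueCount] at hcard
      rwa [hct, hcard] at h
    -- Any two values of t on opposite sides of 1 would do: (1 - t)d has opposite signs there.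
    obtain ⟨k1, k2⟩ := key 2 (by norm_num) (mul_ne_zero (by norm_num) hd0)
    obtain ⟨k3, k4⟩ := key (1 / 2) (by norm_num) (mul_ne_zero (by norm_num) hd0)
    rcases lt_or_gt_of_ne hd0 with h | h
    · have := k1 (by linarith)
      have := k4 (by linarith)
      omega
    · have := k2 (by linarith)
      have := k3 (by linarith)
      omega
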